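/- Let $T\in\mathbb N$ and let $(\Omega,(\mathcal F_t)_{t\in\{0,\dots,T\}},P)$ be a filtered probability space. Let $S=(S_t)_{t\in\{0,\dots,T\}}$ be a real-valued ($d=1$), adapted, almost surely non-negative process, and write $\Delta S_u=S_u-S_{u-1}$. For a $\sigma$-algebra $\mathcal H$, $L^0(\mathbb R,\mathcal H)$ denotes the set of real $\mathcal H$-measurable random variables, identified when almost surely equal; $L^0(\mathbb R_+,\mathcal H)$ and $L^0(\mathbb R_-,\mathcal H)$ are its subsets of non-negative and non-positive elements. For $t\in\{0,\dots,T\}$ put $$\mathcal R_t^T=\Big\{\sum_{u=t+1}^T\theta_{u-1}\Delta S_u-\epsilon^+ :\ \theta_{u-1}\in L^0(\mathbb R,\mathcal F_{u-1}),\ \epsilon^+\in L^0(\mathbb R_+,\mathcal F_T)\Big\},$$ let $\overline{\mathcal R_t^T}$ be its closure for convergence in probability, and let $\mathcal P_{t,T}(0)=\{x\in L^0(\mathbb R,\mathcal F_t):\ x+R=0\text{ a.s. for some }R\in\mathcal R_t^T\}$ for $t<T$ and $\mathcal P_{T,T}(0)=\{0\}$ be the sets of super-hedging prices of the claim $0$.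 Say that * AIP holds if $\mathcal P_{t,T}(0)\cap L^0(\mathbb R_-,\mathcal F_t)=\{0\}$ for all $t\in\{0,\dots,T\}$; * AWIP holds if $\overline{\mathcal R_t^T}\cap L^0(\mathbb R_+,\mathcal F_t)=\{0\}$ for all $t\in\{0,\dots,T\}$; * NA holds if $\mathcal R_t^T\cap L^0(\mathbb R_+,\mathcal F_T)=\{0\}$ for all $t\in\{0,\dots,T\}$. **Theorem.** (a) The following statements are equivalent. 1. AWIP holds. 2. For every $t\in\{0,\dots,T\}$ there is a probability measure $Q\ll P$ with $E_P(dQ/dP\,|\,\mathcal F_t)=1$ such that $(S_u)_{u\in\{t,\dots,T\}}$ is a $Q$-martingale, in the sense that $E_Q(S_v|\mathcal F_u)=S_u$ for $t\le u\le v\le T$, where the conditional expectation is the generalized one of a non-negative random variable (that is, $\int_A S_v\,dQ=\int_A S_u\,dQ$ in $[0,\infty]$ for all $A\in\mathcal F_u$; no integrability is required). 3. AIP holds and $\overline{\mathcal R_t^T}\cap L^0(\mathbb R,\mathcal F_t)=\mathcal R_t^T\cap L^0(\mathbb R,\mathcal F_t)$ for every $t\in\{0,\dots,T\}$. (b) If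 every $S_t$, $t\in\{0,\dots,T\}$, is $P$-integrable, then AWIP is also equivalent to statement 2 with "martingale" in the usual sense, integrability under $Q$ included. (c) Let $\operatorname{ess\,inf}_{\mathcal F_t}S_{t+1}$ (resp. $\operatorname{ess\,sup}_{\mathcal F_t}S_{t+1}$) be the largest (resp. smallest) $\mathcal F_t$-measurable extended-real random variable that is almost surely $\le S_{t+1}$ (resp. $\ge S_{t+1}$). If $P(\operatorname{ess\,inf}_{\mathcal F_t}S_{t+1}=S_t)=P(\operatorname{ess\,sup}_{\mathcal F_t}S_{t+1}=S_t)=0$ for all $t\in\{0,\dots,T-1\}$, then AWIP, AIP and NA are equivalent. -/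

import Mathlib

open MeasureTheory Filter
open scoped ENNReal

namespace InstantProfit

section CondEss

variable {Ω : Type*} {m0 : MeasurableSpace Ω}

/-- `g` is an `m`-conditional essential supremum of the random variable `X`: the smallest (up to
null sets) `m`-measurable extended-real random variable that dominates `X` almost surely. -/
def IsCondEssSup (P : Measure Ω) (m : MeasurableSpace Ω) (X : Ω → ℝ) (g : Ω → EReal) : Prop :=
  Measurable[m] g ∧ (∀ᵐ ω ∂P, (X ω : EReal) ≤ g ω) ∧
    ∀ h : Ω → EReal, Measurable[m] h → (∀ᵐ ω ∂P, (X ω : EReal) ≤ h ω) → ∀ᵐ ω ∂P, g ω ≤ h ω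

/-- `g` is an `m`-conditional essential infimum of the random variable `X`: the largest (up to
null sets) `m`-measurable extended-real random variable that is dominated by `X` almost surely. -/
def IsCondEssInf (P : Measure Ω) (m : MeasurableSpace Ω) (X : Ω → ℝ) (g : Ω → EReal) : Prop :=
  Measurable[m] g ∧ (∀ᵐ ω ∂P, g ω ≤ (X ω : EReal)) ∧
    ∀ h : Ω → EReal, Measurable[m] h → (∀ᵐ ω ∂P, h ω ≤ (X ω : EReal)) → ∀ᵐ ω ∂P, h ω ≤ g ω

/-- The conditional essential supremum, unique up to null sets; it exists by
`condEssSup_spec`. -/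
noncomputable def condEssSup (P : Measure Ω) (m : MeasurableSpace Ω) (X : Ω → ℝ) : Ω → EReal :=
  Classical.epsilon (IsCondEssSup P m X)

/-- The conditional essential infimum, unique up to null sets; it exists by
`condEssInf_spec`. -/
noncomputable def condEssInf (P : Measure Ω) (m : MeasurableSpace Ω) (X : Ω → ℝ) : Ω → EReal :=
  Classical.epsilon (IsCondEssInf P m X)

theorem exists_isCondEssSup (P : Measure Ω) [IsFiniteMeasure P] {X : Ω → ℝ}
    (hX : Measurable X) {m : MeasurableSpace Ω} (hm : m ≤ m0) : ∃ g, IsCondEssSup P m X g := by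
  classical
  let A : ℚ → Set Ω := fun q => {ω | (q : ℝ) < X ω}
  have hA : ∀ q, MeasurableSet[m0] (A q) := fun q => measurableSet_lt measurable_const hX
  let c : ℚ → Ω → ℝ := fun q => P[(A q).indicator (fun _ => (1 : ℝ)) | m]
  have hcm : ∀ q, Measurable[m] (c q) := fun q => stronglyMeasurable_condExp.measurable
  have hint : ∀ q, Integrable ((A q).indicator (fun _ => (1 : ℝ))) P := fun q =>
    (integrable_const (1 : ℝ)).indicator (hA q)
  have hkey : ∀ q (s : Set Ω), MeasurableSet[m] s → ∫ ω in s, c q ω ∂P = P.real (A q ∩ s) := by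
    intro q s hs
    rw [setIntegral_condExp hm (hint q) hs, integral_indicator_const _ (hA q)]
    simp [measureReal_restrict_apply (hA q)]
  have hnn : ∀ q, 0 ≤ᵐ[P] c q := fun q =>
    condExp_nonneg (Eventually.of_forall fun ω => Set.indicator_nonneg (by simp) ω)
  refine ⟨fun ω => ⨆ q : ℚ, if 0 < c q ω then ((q : ℝ) : EReal) else ⊥, ?_, ?_, ?_⟩
  · refine Measurable.iSup fun q => ?_
    exact Measurable.ite (measurableSet_lt measurable_const (hcm q)) measurable_const
      measurable_const
  · have h1 : ∀ q : ℚ, ∀ᵐ ω ∂P, ω ∈ A q → 0 < c q ω := by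
      intro q
      have hs : MeasurableSet[m] {ω | c q ω ≤ 0} := measurableSet_le (hcm q) measurable_const
      have h2 : P.real (A q ∩ {ω | c q ω ≤ 0}) = 0 := by
        refine le_antisymm ?_ measureReal_nonneg
        rw [← hkey q _ hs]
        exact setIntegral_nonpos (hm _ hs) fun ω hω => hω
      have h3 : P (A q ∩ {ω | c q ω ≤ 0}) = 0 := (measureReal_eq_zero_iff).1 h2
      rw [ae_iff]
      convert h3 using 2
      ext ω
      simp
    filter_upwards [ae_all_iff.2 h1] with ω hω
    refine EReal.le_of_forall_lt_iff_le.1 fun z hz => ?_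
    by_contra hcon
    have hlt : (⨆ q : ℚ, if 0 < c q ω then ((q : ℝ) : EReal) else ⊥) < (X ω : EReal) :=
      lt_of_lt_of_le hz (not_le.1 fun hh => hcon hh).le
    obtain ⟨q, hq1, hq2⟩ := EReal.lt_iff_exists_rat_btwn.1 hlt
    have hq : ω ∈ A q := by exact_mod_cast hq2
    have := le_iSup (fun q : ℚ => if 0 < c q ω then ((q : ℝ) : EReal) else ⊥) q
    rw [if_pos (hω q hq)] at this
    exact absurd hq1 (not_lt.2 this)
  · intro h hh hXh
    have h1 : ∀ q : ℚ, ∀ᵐ ω ∂P, h ω < ((q : ℝ) : EReal) → c q ω = 0 := by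
      intro q
      have hs : MeasurableSet[m] {ω | h ω < ((q : ℝ) : EReal)} :=
        measurableSet_lt hh measurable_const
      have h2 : P (A q ∩ {ω | h ω < ((q : ℝ) : EReal)}) = 0 := by
        refine measure_mono_null ?_ (ae_iff.1 hXh)
        rintro ω ⟨hω1, hω2⟩
        have h4 : ((q : ℝ) : EReal) < (X ω : EReal) := by exact_mod_cast hω1
        exact not_le.2 (lt_trans hω2 h4)
      have h3 : ∫ ω in {ω | h ω < ((q : ℝ) : EReal)}, c q ω ∂P = 0 := by
        rw [hkey q _ hs, measureReal_def, h2]; rfl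
      rw [setIntegral_eq_zero_iff_of_nonneg_ae (ae_restrict_of_ae (hnn q))
        integrable_condExp.integrableOn] at h3
      exact (ae_restrict_iff' (hm _ hs)).1 h3
    filter_upwards [ae_all_iff.2 h1] with ω hω
    refine iSup_le fun q => ?_
    split_ifs with hc
    · by_contra hcon
      exact hc.ne' (hω q (not_le.1 hcon))
    · exact bot_le

theorem exists_isCondEssInf (P : Measure Ω) [IsFiniteMeasure P] {X : Ω → ℝ}
    (hX : Measurable X) {m : MeasurableSpace Ω} (hm : m ≤ m0) : ∃ g, IsCondEssInf P m X g := by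
  obtain ⟨g, hg1, hg2, hg3⟩ := exists_isCondEssSup P hX.neg hm
  refine ⟨fun ω => - g ω, hg1.neg, ?_, ?_⟩
  · filter_upwards [hg2] with ω hω
    rw [EReal.neg_le]
    simpa using hω
  · intro h hh hhX
    filter_upwards [hg3 (fun ω => - h ω) hh.neg (by
      filter_upwards [hhX] with ω hω
      simpa using EReal.neg_le_neg_iff.2 hω)] with ω hω
    exact EReal.le_neg_of_le_neg hω

theorem condEssSup_spec (P : Measure Ω) [IsFiniteMeasure P] {X : Ω → ℝ}
    (hX : Measurable X) {m : MeasurableSpace Ω} (hm : m ≤ m0) :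
    IsCondEssSup P m X (condEssSup P m X) :=
  Classical.epsilon_spec (exists_isCondEssSup P hX hm)

theorem condEssInf_spec (P : Measure Ω) [IsFiniteMeasure P] {X : Ω → ℝ}
    (hX : Measurable X) {m : MeasurableSpace Ω} (hm : m ≤ m0) :
    IsCondEssInf P m X (condEssInf P m X) :=
  Classical.epsilon_spec (exists_isCondEssInf P hX hm)

end CondEss

section Market

variable {Ω : Type*} {m0 : MeasurableSpace Ω}

/-- The real random variables that are `m`-measurable (up to a `P`-null set). Random variables are
represented by functions; all the sets of random variables below are stable under `P`-almost sure
equality. -/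
def L0 (P : Measure Ω) (m : MeasurableSpace Ω) : Set (Ω → ℝ) :=
  {X | AEStronglyMeasurable[m] X P}

/-- The almost surely non-negative `m`-measurable random variables. -/
def L0pos (P : Measure Ω) (m : MeasurableSpace Ω) : Set (Ω → ℝ) :=
  {X | X ∈ L0 P m ∧ 0 ≤ᵐ[P] X}

/-- The almost surely non-positive `m`-measurable random variables. -/
def L0neg (P : Measure Ω) (m : MeasurableSpace Ω) : Set (Ω → ℝ) :=
  {X | X ∈ L0 P m ∧ X ≤ᵐ[P] 0}

/-- The singleton `{0}` of the space of random variables modulo almost sure equality. -/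
def zeroClass (P : Measure Ω) : Set (Ω → ℝ) := {X | X =ᵐ[P] 0}

/-- The closure of a set of random variables for convergence in probability (a metrizable
convergence, so that limits of sequences suffice). -/
def closureInProb (P : Measure Ω) (A : Set (Ω → ℝ)) : Set (Ω → ℝ) :=
  {X | X ∈ L0 P m0 ∧ ∃ f : ℕ → Ω → ℝ, (∀ n, f n ∈ A) ∧ TendstoInMeasure P f atTop X}

/-- The claims at the horizon `T` that can be super-replicated from zero initial endowment at
time `t`: the random variables `∑_{u=t+1}^T θ_{u-1} (S_u - S_{u-1}) - ε`, where `θ_u` is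
`F_u`-measurable and `ε ≥ 0` is `F_T`-measurable (the sum is indexed by `u - 1` here). -/
def superReplicable (P : Measure Ω) (F : Filtration ℕ m0) (S : ℕ → Ω → ℝ) (T t : ℕ) :
    Set (Ω → ℝ) :=
  {X | ∃ θ : ℕ → Ω → ℝ, ∃ ε : Ω → ℝ, (∀ u ∈ Finset.Ico t T, θ u ∈ L0 P (F u)) ∧
    ε ∈ L0pos P (F T) ∧
    X =ᵐ[P] fun ω => ∑ u ∈ Finset.Ico t T, θ u ω * (S (u + 1) ω - S u ω) - ε ω}

/-- The super-hedging prices at time `t` of the claim `g` paid at time `T`. -/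
def superHedgingPrices (P : Measure Ω) (F : Filtration ℕ m0) (S : ℕ → Ω → ℝ) (T t : ℕ)
    (g : Ω → ℝ) : Set (Ω → ℝ) :=
  if t = T then {x | x =ᵐ[P] g}
  else {x | x ∈ L0 P (F t) ∧ ∃ R ∈ superReplicable P F S T t, x + R =ᵐ[P] g}

/-- Absence of instantaneous profit. -/
def AIP (P : Measure Ω) (F : Filtration ℕ m0) (S : ℕ → Ω → ℝ) (T : ℕ) : Prop :=
  ∀ t ≤ T, superHedgingPrices P F S T t 0 ∩ L0neg P (F t) = zeroClass P

/-- The no-arbitrage condition. -/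
def NA (P : Measure Ω) (F : Filtration ℕ m0) (S : ℕ → Ω → ℝ) (T : ℕ) : Prop :=
  ∀ t ≤ T, superReplicable P F S T t ∩ L0pos P (F T) = zeroClass P

/-- Absence of weak instantaneous profit. -/
def AWIP (P : Measure Ω) (F : Filtration ℕ m0) (S : ℕ → Ω → ℝ) (T : ℕ) : Prop :=
  ∀ t ≤ T, closureInProb P (superReplicable P F S T t) ∩ L0pos P (F t) = zeroClass P

/-- The non-negative process `(S_u)_{t ≤ u ≤ T}` is adapted and satisfies `E_Q(S_v | F_u) = S_u` for
`t ≤ u ≤ v ≤ T`, where the conditional expectation is that of a non-negative random variable: the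
`F_u`-measurable variable with the same `Q`-integral, in `[0, ∞]`, on every event of `F_u`.
No integrability is required. -/
def IsNonnegMartingaleFrom (Q : Measure Ω) (F : Filtration ℕ m0) (S : ℕ → Ω → ℝ) (T t : ℕ) :
    Prop :=
  (∀ u, t ≤ u → u ≤ T → Measurable[F u] (S u)) ∧
  ∀ u v, t ≤ u → u ≤ v → v ≤ T → ∀ A, MeasurableSet[F u] A →
    ∫⁻ ω in A, ENNReal.ofReal (S v ω) ∂Q = ∫⁻ ω in A, ENNReal.ofReal (S u ω) ∂Q

/-- The process `(S_u)_{t ≤ u ≤ T}` is a `Q`-martingale in the usual sense: adapted, integrable,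
and `E_Q(S_v | F_u) = S_u` for `t ≤ u ≤ v ≤ T`. -/
def IsMartingaleFrom (Q : Measure Ω) (F : Filtration ℕ m0) (S : ℕ → Ω → ℝ) (T t : ℕ) :
    Prop :=
  (∀ u, t ≤ u → u ≤ T → Measurable[F u] (S u) ∧ Integrable (S u) Q) ∧
  ∀ u v, t ≤ u → u ≤ v → v ≤ T → Q[S v | F u] =ᵐ[Q] S u

/-- `Q` is a probability measure, `Q ≪ P` and `E(dQ/dP | F_t) = 1`. -/
def IsACDensityOneAt (P Q : Measure Ω) (F : Filtration ℕ m0) (t : ℕ) : Prop :=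
  IsProbabilityMeasure Q ∧ Q ≪ P ∧ P[fun ω => (Q.rnDeriv P ω).toReal | F t] =ᵐ[P] 1

end Market

end InstantProfit

/-! Everything in (a) and (b) passes through one local condition, `NoSureMove`: no non-null event of
`F u` carries an increment `S (u + 1) - S u` that is almost surely strictly positive, or strictly
negative.

AWIP forces it: if the increment has a strict sign on `A`, the positions `n` or `-n` on `A`, with
gains truncated at 1, super-replicate claims tending to the indicator of `A`
(`indicator_mem_closureInProb`).

Conversely, let an `F t`-measurable `X` be a limit of super-replicable claims. Along an almost
surely convergent subsequence, `X` is dominated by the liminf of the gains. The last period can be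
deleted from the gains: where the earlier gains fall short infinitely often with `θ n ≥ 0`, the next
increment would have to be strictly positive, on an event of the past; the case `θ n ≤ 0` is
symmetric (`AsympGE.of_add_mul`). Backward induction leaves the empty sum, so `X ≤ 0`
(`NoSureMove.ae_le_zero`). No bound or convergence of the strategies is needed. This gives AWIP, AIP
and the closure identity.

For martingale measures, each one-period increment is balanced by an explicit conditional density,
and the densities are multiplied over time. A density may vanish, hence only `Q ≪ P`. In return, `Q
= P` on `F u` and equal integrals of `S u` and `S (u + 1)` on events of `F u` exclude a strict sign.

In (c), the hypothesis on the conditional bounds turns AIP into the stronger `NoSureWeakMove`, with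
weak signs in place of strict ones. That condition makes every non-negative gain vanish period by
period, which is NA. -/

namespace InstantProfit

/-! ### One-period conditional densities. -/

section Density

variable {Ω : Type*} {G m0 : MeasurableSpace Ω} {P : Measure Ω}

/-- No non-null event of `G` on which `D` is almost surely positive. -/
def NotSurelyPos (P : Measure Ω) (G : MeasurableSpace Ω) (D : Ω → ℝ) : Prop :=
  ∀ A, MeasurableSet[G] A → (∀ᵐ ω ∂P, ω ∈ A → 0 < D ω) → P A = 0

/-- Functions with the same integral on every event of `G` have the same integral against every
non-negative `G`-measurable function. -/
theorem lintegral_mul_eq_of_forall_setLIntegral_eq (hG : G ≤ m0) {X Y : Ω → ℝ≥0∞}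
    (hX : Measurable X) (hY : Measurable Y)
    (h : ∀ A, MeasurableSet[G] A → ∫⁻ ω in A, X ω ∂P = ∫⁻ ω in A, Y ω ∂P)
    {f : Ω → ℝ≥0∞} (hf : Measurable[G] f) :
    ∫⁻ ω, f ω * X ω ∂P = ∫⁻ ω, f ω * Y ω ∂P := by
  have htrim : (P.withDensity X).trim hG = (P.withDensity Y).trim hG := by
    refine @Measure.ext _ G _ _ fun A hA => ?_
    rw [trim_measurableSet_eq hG hA, trim_measurableSet_eq hG hA, withDensity_apply _ (hG A hA),
      withDensity_apply _ (hG A hA), h A hA]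
  have hf' := hf.mono hG le_rfl
  calc ∫⁻ ω, f ω * X ω ∂P = ∫⁻ ω, f ω ∂(P.withDensity X) := by
        rw [lintegral_withDensity_eq_lintegral_mul _ hX hf']
        simp [mul_comm]
    _ = ∫⁻ ω, f ω ∂(P.withDensity Y) := by
        rw [← lintegral_trim hG hf, htrim, lintegral_trim hG hf]
    _ = ∫⁻ ω, f ω * Y ω ∂P := by
        rw [lintegral_withDensity_eq_lintegral_mul _ hY hf']
        simp [mul_comm]

/-- Working in `[0, ∞]` allows a `G`-measurable factor to be pulled out with no integrability
assumption. -/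
theorem lintegral_mul_condLExp [IsFiniteMeasure P] (hG : G ≤ m0) {X f : Ω → ℝ≥0∞}
    (hX : Measurable X) (hf : Measurable[G] f) :
    ∫⁻ ω, f ω * X ω ∂P = ∫⁻ ω, f ω * P⁻[X|G] ω ∂P :=
  lintegral_mul_eq_of_forall_setLIntegral_eq hG hX (measurable_condLExp' G P X)
    (fun _ hA => (setLIntegral_condLExp hG P X hA).symm) hf

theorem ae_eq_zero_of_condLExp_eq_zero [IsFiniteMeasure P] (hG : G ≤ m0) {X : Ω → ℝ≥0∞}
    (hX : Measurable X) : ∀ᵐ ω ∂P, P⁻[X|G] ω = 0 → X ω = 0 := by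
  have hA : MeasurableSet[G] {ω | P⁻[X|G] ω = 0} :=
    measurable_condLExp G P X (measurableSet_singleton 0)
  have h := setLIntegral_condLExp hG P X hA
  rw [setLIntegral_congr_fun (hG _ hA) (g := fun _ => 0) (fun ω hω => hω), lintegral_zero] at h
  have h' := (lintegral_eq_zero_iff hX).1 h.symm
  exact (ae_restrict_iff' (hG _ hA)).1 h'

/-- If neither `D` nor `-D` is surely positive on a non-null event of `G`, there is a conditional
probability density under which `D` has conditional mean zero. -/
theorem exists_density_balanced [IsProbabilityMeasure P] {H : MeasurableSpace Ω} (hGH : G ≤ H)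
    (hH : H ≤ m0) {D : Ω → ℝ} (hD : Measurable[H] D) (hpos : NotSurelyPos P G D)
    (hneg : NotSurelyPos P G (-D)) :
    ∃ Z : Ω → ℝ≥0∞, Measurable[H] Z ∧
      (∀ f : Ω → ℝ≥0∞, Measurable[G] f → ∫⁻ ω, f ω * Z ω ∂P = ∫⁻ ω, f ω ∂P) ∧
      (∀ f : Ω → ℝ≥0∞, Measurable[G] f → ∫⁻ ω, f ω * (Z ω * ENNReal.ofReal (D ω)) ∂P =
        ∫⁻ ω, f ω * (Z ω * ENNReal.ofReal (-D ω)) ∂P) := by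
  have hG := hGH.trans hH
  -- `D` need not be integrable. The weight makes both parts of `w * D` bounded by 1, and being
  -- nowhere zero it does not change where they vanish.
  let w : Ω → ℝ≥0∞ := fun ω => ENNReal.ofReal (1 / (1 + |D ω|))
  have hw : Measurable[H] w := by
    refine ENNReal.measurable_ofReal.comp ?_
    exact measurable_const.div (measurable_const.add
      (continuous_abs.measurable.comp hD))
  have hw0 : ∀ ω, w ω ≠ 0 := fun ω => by
    simp only [w, ne_eq, ENNReal.ofReal_eq_zero, not_le]; positivity
  have hwle : ∀ (x ω), x ≤ |D ω| → w ω * ENNReal.ofReal x ≤ 1 := fun x ω hx => by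
    rw [← ENNReal.ofReal_mul (by positivity)]
    refine ENNReal.ofReal_le_one.2 ?_
    rw [div_mul_eq_mul_div, one_mul, div_le_one (by positivity)]
    linarith
  let p : Ω → ℝ≥0∞ := fun ω => w ω * ENNReal.ofReal (D ω)
  let q : Ω → ℝ≥0∞ := fun ω => w ω * ENNReal.ofReal (-D ω)
  have hp : Measurable[H] p := hw.mul (ENNReal.measurable_ofReal.comp hD)
  have hq : Measurable[H] q := hw.mul (ENNReal.measurable_ofReal.comp hD.neg)
  let a : Ω → ℝ≥0∞ := P⁻[p|G]
  let b : Ω → ℝ≥0∞ := P⁻[q|G]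
  have ha : Measurable[G] a := measurable_condLExp G P p
  have hb : Measurable[G] b := measurable_condLExp G P q
  have ha_int : ∫⁻ ω, a ω ∂P ≤ 1 := by
    rw [show ∫⁻ ω, a ω ∂P = _ from lintegral_condLExp hG P p]
    exact (lintegral_mono fun ω => hwle _ ω (le_abs_self _)).trans (by simp)
  have hb_int : ∫⁻ ω, b ω ∂P ≤ 1 := by
    rw [show ∫⁻ ω, b ω ∂P = _ from lintegral_condLExp hG P q]
    exact (lintegral_mono fun ω => hwle _ ω (neg_le_abs _)).trans (by simp)
  -- Cross-weighting: the positive part, of conditional mean `a`, is multiplied by `b`, and the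
  -- negative part, of conditional mean `b`, by `a`, so both acquire mean `a * b`. The value 1 on `D
  -- = 0` keeps mass there when `a` or `b` vanishes.
  let r : Ω → ℝ≥0∞ := fun ω => if 0 < D ω then b ω else if D ω < 0 then a ω else 1
  have hr : Measurable[H] r :=
    Measurable.ite (measurableSet_lt measurable_const hD) (hb.mono hGH le_rfl)
      (Measurable.ite (measurableSet_lt hD measurable_const) (ha.mono hGH le_rfl)
        measurable_const)
  let Y : Ω → ℝ≥0∞ := fun ω => w ω * r ω
  have hY : Measurable[H] Y := hw.mul hr
  let n : Ω → ℝ≥0∞ := P⁻[Y|G]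
  have hn : Measurable[G] n := measurable_condLExp G P Y
  have hY_int : ∫⁻ ω, Y ω ∂P ≠ ∞ := by
    have hle : ∀ ω, Y ω ≤ a ω + b ω + 1 := fun ω => by
      have hw1 : w ω ≤ 1 := ENNReal.ofReal_le_one.2
        ((div_le_one (by positivity)).2 (by linarith [abs_nonneg (D ω)]))
      calc Y ω ≤ 1 * r ω := mul_le_mul_left hw1 _
        _ = r ω := one_mul _
        _ ≤ _ := by
          simp only [r]
          split_ifs
          · exact le_add_right (le_add_left le_rfl)
          · exact le_add_right (le_add_right le_rfl)
          · exact le_add_left le_rfl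
    refine ne_top_of_le_ne_top ?_ (lintegral_mono hle)
    rw [lintegral_add_right _ measurable_const,
      lintegral_add_right _ (hb.mono hG le_rfl)]
    simp only [lintegral_const, measure_univ, mul_one]
    exact ne_top_of_le_ne_top (by norm_num : (1 + 1 + 1 : ℝ≥0∞) ≠ ∞)
      (add_le_add (add_le_add ha_int hb_int) le_rfl)
  have hn_top : ∀ᵐ ω ∂P, n ω ≠ ∞ := condLExp_ne_top hY_int
  have hq0 : ∀ᵐ ω ∂P, b ω = 0 → ¬ D ω < 0 := by
    filter_upwards [ae_eq_zero_of_condLExp_eq_zero hG (hq.mono hH le_rfl)] with ω h1 h2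
    simpa [q, hw0] using h1 h2
  have hY0 : ∀ᵐ ω ∂P, n ω = 0 → r ω = 0 := by
    filter_upwards [ae_eq_zero_of_condLExp_eq_zero hG (hY.mono hH le_rfl)] with ω h1 h2
    simpa [Y, hw0] using h1 h2
  have hzero : MeasurableSet[G] {ω | n ω = 0} := hn (measurableSet_singleton 0)
  -- Where the normaliser vanishes, so does `r`, which excludes `D = 0`. If also `b = 0`, then `D <
  -- 0` is excluded and `D > 0` surely; if `b ≠ 0`, then `D > 0` is excluded and `D < 0` surely.
  -- Both events lie in `G`.
  have hn_zero : ∀ᵐ ω ∂P, n ω ≠ 0 := by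
    have h1 : P ({ω | n ω = 0} ∩ {ω | b ω = 0}) = 0 := by
      refine hpos _ (hzero.inter (hb (measurableSet_singleton 0))) ?_
      filter_upwards [hq0, hY0] with ω hq hY hω
      have h2 := hY hω.1
      have h3 := hq hω.2
      by_contra h4
      simp [r, h3, h4] at h2
    have h2 : P ({ω | n ω = 0} ∩ {ω | b ω = 0}ᶜ) = 0 := by
      refine hneg _ (hzero.inter (hb (measurableSet_singleton 0)).compl) ?_
      filter_upwards [hY0] with ω hY hω
      have h2 := hY hω.1
      by_contra h4
      have h4' : ¬ D ω < 0 := by simpa using h4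
      simp only [r, h4', if_false] at h2
      split_ifs at h2
      · exact hω.2 h2
      · exact one_ne_zero h2
    have h3 := measure_union_null h1 h2
    rw [Set.inter_union_compl] at h3
    exact measure_eq_zero_iff_ae_notMem.1 h3
  have hinv : Measurable[G] fun ω => (n ω)⁻¹ := hn.inv
  refine ⟨fun ω => (n ω)⁻¹ * Y ω, (hinv.mono hGH le_rfl).mul hY, fun f hf => ?_, fun f hf => ?_⟩
  · calc ∫⁻ ω, f ω * ((n ω)⁻¹ * Y ω) ∂P = ∫⁻ ω, (f ω * (n ω)⁻¹) * Y ω ∂P := by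
          simp only [mul_assoc]
      _ = ∫⁻ ω, (f ω * (n ω)⁻¹) * n ω ∂P :=
          lintegral_mul_condLExp hG (hY.mono hH le_rfl) (hf.mul hinv)
      _ = ∫⁻ ω, f ω ∂P := by
          refine lintegral_congr_ae ?_
          filter_upwards [hn_top, hn_zero] with ω h1 h2
          rw [mul_assoc, ENNReal.inv_mul_cancel h2 h1, mul_one]
  · have h1 : ∀ ω, f ω * ((n ω)⁻¹ * Y ω * ENNReal.ofReal (D ω)) =
        f ω * (n ω)⁻¹ * b ω * p ω := fun ω => by
      by_cases h : 0 < D ω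
      · simp only [Y, r, p, h, if_true]; ring
      · simp [p, ENNReal.ofReal_of_nonpos (not_lt.1 h)]
    have h2 : ∀ ω, f ω * ((n ω)⁻¹ * Y ω * ENNReal.ofReal (-D ω)) =
        f ω * (n ω)⁻¹ * a ω * q ω := fun ω => by
      by_cases h : D ω < 0
      · simp only [Y, r, q, h, h.le.not_gt, if_true, if_false]; ring
      · simp [q, ENNReal.ofReal_of_nonpos (neg_nonpos.2 (not_lt.1 h))]
    simp only [h1, h2]
    refine (lintegral_mul_condLExp hG (hp.mono hH le_rfl) ((hf.mul hinv).mul hb)).trans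
      (Eq.trans (lintegral_congr fun ω => ?_)
        (lintegral_mul_condLExp hG (hq.mono hH le_rfl) ((hf.mul hinv).mul ha)).symm)
    change f ω * (n ω)⁻¹ * b ω * a ω = f ω * (n ω)⁻¹ * a ω * b ω
    ring

/-- One-step martingale density for a non-negative price. -/
theorem exists_density_martingale_step [IsProbabilityMeasure P] {H : MeasurableSpace Ω}
    (hGH : G ≤ H) (hH : H ≤ m0) {s s' : Ω → ℝ} (hs : Measurable[G] s) (hs' : Measurable[H] s')
    (hs0 : 0 ≤ᵐ[P] s) (hs0' : 0 ≤ᵐ[P] s') (hpos : NotSurelyPos P G (s' - s))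
    (hneg : NotSurelyPos P G (-(s' - s))) :
    ∃ Z : Ω → ℝ≥0∞, Measurable[H] Z ∧
      (∀ f : Ω → ℝ≥0∞, Measurable[G] f → ∫⁻ ω, f ω * Z ω ∂P = ∫⁻ ω, f ω ∂P) ∧
      (∀ f : Ω → ℝ≥0∞, Measurable[G] f → ∫⁻ ω, f ω * (Z ω * ENNReal.ofReal (s' ω)) ∂P =
        ∫⁻ ω, f ω * ENNReal.ofReal (s ω) ∂P) := by
  have hG := hGH.trans hH
  obtain ⟨Z, hZ, hZ1, hZD⟩ := exists_density_balanced hGH hH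
    (hs'.sub (hs.mono hGH le_rfl)) hpos hneg
  have hZ0 := hZ.mono hH le_rfl
  have hs0m := hs.mono hG le_rfl
  have hs0m' := hs'.mono hH le_rfl
  refine ⟨Z, hZ, hZ1, fun f hf => ?_⟩
  have hfin : ∀ A, MeasurableSet[G] A → ∫⁻ ω in A, ENNReal.ofReal (s ω) ∂P ≠ ∞ →
      ∫⁻ ω in A, Z ω * ENNReal.ofReal (s' ω) ∂P = ∫⁻ ω in A, ENNReal.ofReal (s ω) ∂P := by
    intro A hA hAfin
    have hind : ∀ g : Ω → ℝ≥0∞, ∫⁻ ω in A, g ω ∂P =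
        ∫⁻ ω, A.indicator (fun _ => 1) ω * g ω ∂P := fun g => by
      rw [← lintegral_indicator (hG A hA)]
      refine lintegral_congr fun ω => ?_
      by_cases h : ω ∈ A <;> simp [h]
    have hone : Measurable[G] (A.indicator (fun _ => (1 : ℝ≥0∞))) :=
      measurable_const.indicator hA
    have hZs : ∫⁻ ω in A, Z ω * ENNReal.ofReal (s ω) ∂P = ∫⁻ ω in A, ENNReal.ofReal (s ω) ∂P := by
      rw [hind, hind]
      refine Eq.trans (lintegral_congr fun ω => ?_)
        (hZ1 _ (hone.mul (ENNReal.measurable_ofReal.comp hs)))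
      ring
    have hbal := hZD _ hone
    rw [← hind, ← hind] at hbal
    simp only [Pi.sub_apply] at hbal
    -- Non-negativity of `s'` bounds the negative part of the increment by `s`. This finiteness
    -- permits the cancellation in `hsum`, although `s'` is not known to be integrable.
    have hneg_fin : ∫⁻ ω in A, Z ω * ENNReal.ofReal (-(s' ω - s ω)) ∂P ≠ ∞ := by
      rw [← hZs] at hAfin
      refine ne_top_of_le_ne_top hAfin (lintegral_mono_ae ?_)
      filter_upwards [ae_restrict_of_ae hs0'] with ω hω
      refine mul_le_mul_right (ENNReal.ofReal_le_ofReal ?_) _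
      have : 0 ≤ s' ω := hω
      linarith
    have hsum : ∫⁻ ω in A, Z ω * ENNReal.ofReal (s' ω) ∂P +
        ∫⁻ ω in A, Z ω * ENNReal.ofReal (-(s' ω - s ω)) ∂P =
        ∫⁻ ω in A, Z ω * ENNReal.ofReal (s ω) ∂P +
        ∫⁻ ω in A, Z ω * ENNReal.ofReal (s' ω - s ω) ∂P := by
      rw [← lintegral_add_right _ (by fun_prop), ← lintegral_add_right _ (by fun_prop)]
      refine lintegral_congr_ae ?_
      filter_upwards [ae_restrict_of_ae hs0, ae_restrict_of_ae hs0'] with ω h1 h2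
      have h1 : 0 ≤ s ω := h1
      have h2 : 0 ≤ s' ω := h2
      rw [← mul_add, ← mul_add]
      congr 1
      rcases le_total (s ω) (s' ω) with h | h
      · rw [ENNReal.ofReal_of_nonpos (p := -(s' ω - s ω)) (by linarith), add_zero,
          ← ENNReal.ofReal_add h1 (by linarith)]
        congr 1; ring
      · rw [ENNReal.ofReal_of_nonpos (p := s' ω - s ω) (by linarith), add_zero,
          ← ENNReal.ofReal_add h2 (by linarith)]
        congr 1; ring
    rw [hbal, ENNReal.add_left_inj hneg_fin, hZs] at hsum
    exact hsum
  refine lintegral_mul_eq_of_forall_setLIntegral_eq hG (hZ0.mul hs0m'.ennreal_ofReal)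
    hs0m.ennreal_ofReal (fun A hA => ?_) hf
  -- On each slice `s` is at most `k + 1`, so `hfin` applies; countable additivity then removes the
  -- finiteness assumption.
  let B : ℕ → Set Ω := fun k => A ∩ {ω | ⌊s ω⌋₊ = k}
  have hB : ∀ k, MeasurableSet[G] (B k) := fun k =>
    hA.inter ((Nat.measurable_floor.comp hs) (measurableSet_singleton k))
  have hBU : A = ⋃ k, B k := by
    ext ω; simp [B]
  have hBd : Pairwise (Function.onFun Disjoint B) := fun i j hij => by
    refine Set.disjoint_left.2 fun ω h1 h2 => hij ?_
    exact h1.2.symm.trans h2.2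
  rw [hBU, lintegral_iUnion (fun k => hG _ (hB k)) hBd, lintegral_iUnion (fun k => hG _ (hB k)) hBd]
  refine tsum_congr fun k => hfin _ (hB k) ?_
  refine ne_top_of_le_ne_top (ENNReal.mul_ne_top (ENNReal.ofReal_ne_top (r := (k : ℝ) + 1))
    (measure_ne_top P (B k))) ((setLIntegral_mono (g := fun _ => ENNReal.ofReal ((k : ℝ) + 1))
      measurable_const fun ω hω => ?_).trans (setLIntegral_const _ _).le)
  refine ENNReal.ofReal_le_ofReal ?_
  have : ⌊s ω⌋₊ = k := hω.2
  rw [← this]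
  exact (Nat.lt_floor_add_one _).le

end Density

end InstantProfit

namespace InstantProfit

/-! ### Martingale measures and the one-period sign condition. -/

section Martingale

variable {Ω : Type*} {m0 : MeasurableSpace Ω} {P Q : Measure Ω} {F : Filtration ℕ m0}
  {S : ℕ → Ω → ℝ} {T t : ℕ}

/-- No one-period price increment is almost surely of one strict sign on a non-null event of the
past. -/
def NoSureMove (P : Measure Ω) (F : Filtration ℕ m0) (S : ℕ → Ω → ℝ) (T : ℕ) : Prop :=
  ∀ u < T, NotSurelyPos P (F u) (S (u + 1) - S u) ∧ NotSurelyPos P (F u) (-(S (u + 1) - S u))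

/-- The conditional expectation of the density is the density of the restrictions to `F t`; when it
is 1 the restrictions coincide. -/
theorem IsACDensityOneAt.measure_eq [IsProbabilityMeasure P] (h : IsACDensityOneAt P Q F t)
    {A : Set Ω} (hA : MeasurableSet[F t] A) : Q A = P A := by
  obtain ⟨hQ, hac, hden⟩ := h
  have h1 := toReal_rnDeriv_trim (F.le t) hac
  have hden' : (P[fun ω => (Q.rnDeriv P ω).toReal | F t]) =ᵐ[P.trim (F.le t)] fun _ => 1 :=
    StronglyMeasurable.ae_eq_trim_of_stronglyMeasurable (F.le t) stronglyMeasurable_condExp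
      stronglyMeasurable_const hden
  have h2 : (Q.trim (F.le t)).rnDeriv (P.trim (F.le t)) =ᵐ[P.trim (F.le t)] fun _ => 1 := by
    filter_upwards [h1, hden'] with ω h1 h2
    rw [h2] at h1
    exact (ENNReal.toReal_eq_one_iff _).1 h1
  have h3 := Measure.withDensity_rnDeriv_eq _ _ (hac.trim (F.le t))
  rw [withDensity_congr_ae h2] at h3
  change (P.trim (F.le t)).withDensity 1 = _ at h3
  rw [withDensity_one] at h3
  rw [← trim_measurableSet_eq (F.le t) hA, ← h3, trim_measurableSet_eq (F.le t) hA]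

theorem IsACDensityOneAt.trim_eq [IsProbabilityMeasure P] (h : IsACDensityOneAt P Q F t) :
    Q.trim (F.le t) = P.trim (F.le t) := by
  refine @Measure.ext _ (F t) _ _ fun A hA => ?_
  rw [trim_measurableSet_eq (F.le t) hA, trim_measurableSet_eq (F.le t) hA, h.measure_eq hA]

theorem isACDensityOneAt_of_measure_eq [IsProbabilityMeasure P] (hac : Q ≪ P)
    (h : ∀ A, MeasurableSet[F t] A → Q A = P A) : IsACDensityOneAt P Q F t := by
  have hQ : IsProbabilityMeasure Q := ⟨by rw [h _ MeasurableSet.univ, measure_univ]⟩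
  refine ⟨hQ, hac, ?_⟩
  have htrim : Q.trim (F.le t) = P.trim (F.le t) := by
    refine @Measure.ext _ (F t) _ _ fun A hA => ?_
    rw [trim_measurableSet_eq (F.le t) hA, trim_measurableSet_eq (F.le t) hA, h A hA]
  have h1 := ae_eq_of_ae_eq_trim (toReal_rnDeriv_trim (F.le t) hac)
  rw [htrim] at h1
  have h2 := ae_eq_of_ae_eq_trim (Measure.rnDeriv_self (P.trim (F.le t)))
  filter_upwards [h1, h2] with ω h1 h2
  rw [← h1, h2]
  simp

/-- The density is the product of the one-period densities. Testing against functions rather than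
events lets the earlier product and earlier prices be absorbed into the test function, so a new
factor, of conditional mean 1, leaves all earlier identities intact. -/
theorem exists_martingale_density [IsProbabilityMeasure P]
    (hS : ∀ u ≤ T, Measurable[F u] (S u)) (hS0 : ∀ u ≤ T, 0 ≤ᵐ[P] S u)
    (hL : NoSureMove P F S T) (v : ℕ) (htv : t ≤ v) (hvT : v ≤ T) :
    ∃ M : Ω → ℝ≥0∞, Measurable[F v] M ∧
      (∀ f : Ω → ℝ≥0∞, Measurable[F t] f → ∫⁻ ω, f ω * M ω ∂P = ∫⁻ ω, f ω ∂P) ∧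
      ∀ u, t ≤ u → u < v → ∀ f : Ω → ℝ≥0∞, Measurable[F u] f →
        ∫⁻ ω, f ω * ENNReal.ofReal (S (u + 1) ω) * M ω ∂P =
          ∫⁻ ω, f ω * ENNReal.ofReal (S u ω) * M ω ∂P := by
  induction v, htv using Nat.le_induction with
  | base => exact ⟨fun _ => 1, measurable_const, by simp, fun u h1 h2 => absurd h1 h2.not_ge⟩
  | succ v htv ih =>
    obtain ⟨M, hM, hM1, hMS⟩ := ih (Nat.le_of_succ_le hvT)
    have hv : v ≤ T := Nat.le_of_succ_le hvT
    obtain ⟨Z, hZ, hZ1, hZS⟩ := exists_density_martingale_step (P := P) (F.mono v.le_succ)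
      (F.le (v + 1)) (hS v hv) (hS (v + 1) hvT) (hS0 v hv) (hS0 (v + 1) hvT)
      (hL v hvT).1 (hL v hvT).2
    have hdrop : ∀ f : Ω → ℝ≥0∞, Measurable[F v] f →
        ∫⁻ ω, f ω * (M ω * Z ω) ∂P = ∫⁻ ω, f ω * M ω ∂P := fun f hf => by
      refine Eq.trans (lintegral_congr fun ω => ?_) (hZ1 _ (hf.mul hM))
      rw [mul_assoc]
    refine ⟨fun ω => M ω * Z ω, (hM.mono (F.mono v.le_succ) le_rfl).mul hZ, fun f hf => ?_,
      fun u htu huv f hf => ?_⟩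
    · rw [hdrop f (hf.mono (F.mono htv) le_rfl), hM1 f hf]
    · have hu : u ≤ v := Nat.le_of_lt_succ huv
      have hfv := hf.mono (F.mono hu) le_rfl
      have hSu : Measurable[F v] fun ω => ENNReal.ofReal (S u ω) :=
        ENNReal.measurable_ofReal.comp ((hS u (hu.trans hv)).mono (F.mono hu) le_rfl)
      rw [hdrop (fun ω => f ω * ENNReal.ofReal (S u ω)) (hfv.mul hSu)]
      rcases hu.eq_or_lt with rfl | hlt
      · calc ∫⁻ ω, f ω * ENNReal.ofReal (S (u + 1) ω) * (M ω * Z ω) ∂P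
            = ∫⁻ ω, (f ω * M ω) * (Z ω * ENNReal.ofReal (S (u + 1) ω)) ∂P :=
              lintegral_congr fun ω => by ring
          _ = ∫⁻ ω, (f ω * M ω) * ENNReal.ofReal (S u ω) ∂P := hZS _ (hf.mul hM)
          _ = _ := lintegral_congr fun ω => by ring
      · have hSu' : Measurable[F v] fun ω => ENNReal.ofReal (S (u + 1) ω) :=
          ENNReal.measurable_ofReal.comp
            ((hS (u + 1) (Nat.succ_le_of_lt (hlt.trans_le hv))).mono (F.mono hlt) le_rfl)
        rw [hdrop (fun ω => f ω * ENNReal.ofReal (S (u + 1) ω)) (hfv.mul hSu')]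
        exact hMS u htu hlt f hf

theorem NoSureMove.exists_martingale_measure [IsProbabilityMeasure P]
    (hS : ∀ u ≤ T, Measurable[F u] (S u)) (hS0 : ∀ u ≤ T, 0 ≤ᵐ[P] S u)
    (hL : NoSureMove P F S T) (ht : t ≤ T) :
    ∃ Q : Measure Ω, IsACDensityOneAt P Q F t ∧ IsNonnegMartingaleFrom Q F S T t := by
  obtain ⟨M, hM, hM1, hMS⟩ := exists_martingale_density hS hS0 hL T ht le_rfl
  have hM0 := hM.mono (F.le T) le_rfl
  have hind : ∀ (A : Set Ω), MeasurableSet A → ∀ g : Ω → ℝ≥0∞, ∫⁻ ω in A, g ω ∂P =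
      ∫⁻ ω, A.indicator (fun _ => 1) ω * g ω ∂P := fun A hA g => by
    rw [← lintegral_indicator hA]
    refine lintegral_congr fun ω => ?_
    by_cases h : ω ∈ A <;> simp [h]
  refine ⟨P.withDensity M, isACDensityOneAt_of_measure_eq (withDensity_absolutelyContinuous P M)
    fun A hA => ?_, fun u _ hu => hS u hu, fun u v htu huv hvT A hA => ?_⟩
  · rw [withDensity_apply _ (F.le t A hA), hind A (F.le t A hA),
      hM1 _ (measurable_const.indicator hA), lintegral_indicator_const (F.le t A hA), one_mul]
  · induction v, huv using Nat.le_induction with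
    | base => rfl
    | succ v huv ih =>
      rw [← ih (Nat.le_of_succ_le hvT)]
      have hv : v ≤ T := Nat.le_of_succ_le hvT
      have hA0 := F.le u A hA
      have hconv : ∀ w ≤ T, ∫⁻ ω in A, ENNReal.ofReal (S w ω) ∂(P.withDensity M) =
          ∫⁻ ω, A.indicator (fun _ => 1) ω * ENNReal.ofReal (S w ω) * M ω ∂P := fun w hw => by
        have hSw : Measurable fun ω => ENNReal.ofReal (S w ω) :=
          ((hS w hw).mono (F.le w) le_rfl).ennreal_ofReal
        rw [setLIntegral_withDensity_eq_setLIntegral_mul _ hM0 hSw hA0, hind A hA0]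
        refine lintegral_congr fun ω => ?_
        simp only [Pi.mul_apply]; ring
      rw [hconv _ hvT, hconv _ hv]
      exact hMS v (htu.trans huv) hvT _ (measurable_const.indicator (F.mono huv A hA))

/-- If `s` and `s'` have the same integrals on the events of `G`, then `s < s'` almost surely only
on null events of `G`. -/
theorem measure_eq_zero_of_setLIntegral_eq [IsFiniteMeasure Q] {G : MeasurableSpace Ω}
    (hG : G ≤ m0) {s s' g : Ω → ℝ} (hs' : Measurable[m0] s') (hg : Measurable[G] g)
    (heq : ∀ A, MeasurableSet[G] A →
      ∫⁻ ω in A, ENNReal.ofReal (s ω) ∂Q = ∫⁻ ω in A, ENNReal.ofReal (s' ω) ∂Q)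
    (hfin : ∀ A, MeasurableSet[G] A → ∀ k : ℕ, (∀ ω ∈ A, g ω ≤ k) →
      ∫⁻ ω in A, ENNReal.ofReal (s ω) ∂Q ≠ ∞)
    (hs0 : 0 ≤ᵐ[Q] s) {A : Set Ω} (hA : MeasurableSet[G] A)
    (hlt : ∀ᵐ ω ∂Q, ω ∈ A → s ω < s' ω) : Q A = 0 := by
  -- Strict monotonicity of the integral needs finiteness, which is available only where `g` is
  -- bounded.
  have hAU : A = ⋃ k : ℕ, A ∩ {ω | g ω ≤ k} := by
    rw [← Set.inter_iUnion, eq_comm, Set.inter_eq_left]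
    intro ω _
    obtain ⟨k, hk⟩ := exists_nat_ge (g ω)
    exact Set.mem_iUnion.2 ⟨k, hk⟩
  rw [hAU, measure_iUnion_null_iff]
  intro k
  have hB : MeasurableSet[G] (A ∩ {ω | g ω ≤ k}) := hA.inter (measurableSet_le hg measurable_const)
  by_contra hne
  refine (setLIntegral_strict_mono (hG _ hB) hne hs'.ennreal_ofReal
    (hfin _ hB k fun ω hω => hω.2) ?_).ne (heq _ hB)
  filter_upwards [hlt, hs0] with ω h1 h2 hω
  exact (ENNReal.ofReal_lt_ofReal_iff (lt_of_le_of_lt h2 (h1 hω.1))).2 (h1 hω.1)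

theorem noSureMove_of_martingale_measures [IsProbabilityMeasure P]
    (hS : ∀ u ≤ T, Measurable[F u] (S u)) (hS0 : ∀ u ≤ T, 0 ≤ᵐ[P] S u)
    (h : ∀ t ≤ T, ∃ Q : Measure Ω, IsACDensityOneAt P Q F t ∧ IsNonnegMartingaleFrom Q F S T t) :
    NoSureMove P F S T := by
  intro u hu
  obtain ⟨Q, hQ, hmart⟩ := h u hu.le
  have heq := hmart.2 u (u + 1) le_rfl u.le_succ hu
  have hprob := hQ.1
  have hac := hQ.2.1
  have hfin : ∀ A, MeasurableSet[F u] A → ∀ k : ℕ, (∀ ω ∈ A, S u ω ≤ k) →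
      ∫⁻ ω in A, ENNReal.ofReal (S u ω) ∂Q ≠ ∞ := fun A hA k hk => by
    refine ne_top_of_le_ne_top (ENNReal.mul_ne_top (ENNReal.ofReal_ne_top (r := (k : ℝ)))
      (measure_ne_top Q A)) ((setLIntegral_mono (g := fun _ => ENNReal.ofReal k) measurable_const
        fun ω hω => ENNReal.ofReal_le_ofReal (hk ω hω)).trans (setLIntegral_const _ _).le)
  constructor
  · intro A hA hpos
    rw [← hQ.measure_eq hA]
    refine measure_eq_zero_of_setLIntegral_eq (F.le u) ((hS (u + 1) hu).mono (F.le _) le_rfl)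
      (hS u hu.le) (fun B hB => (heq B hB).symm) hfin (hac.ae_le (hS0 u hu.le)) hA ?_
    filter_upwards [hac.ae_le hpos] with ω hω hωA
    simpa using hω hωA
  · intro A hA hpos
    -- Here the larger variable is `S u`; the slices are still by `S u`, and finiteness for `S (u +
    -- 1)` is inherited from the equality of integrals.
    rw [← hQ.measure_eq hA]
    refine measure_eq_zero_of_setLIntegral_eq (F.le u) ((hS u hu.le).mono (F.le _) le_rfl)
      (hS u hu.le) heq (fun B hB k hk => ?_) (hac.ae_le (hS0 (u + 1) hu)) hA ?_
    · rw [heq B hB]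
      exact hfin B hB k hk
    · filter_upwards [hac.ae_le hpos] with ω hω hωA
      simpa using hω hωA

theorem setIntegral_eq_of_setLIntegral_eq {s s' : Ω → ℝ} (hs : Integrable s Q)
    (hs' : Integrable s' Q) (h0 : 0 ≤ᵐ[Q] s) (h0' : 0 ≤ᵐ[Q] s') (A : Set Ω) :
    ∫⁻ ω in A, ENNReal.ofReal (s ω) ∂Q = ∫⁻ ω in A, ENNReal.ofReal (s' ω) ∂Q ↔
      ∫ ω in A, s ω ∂Q = ∫ ω in A, s' ω ∂Q := by
  rw [← ofReal_integral_eq_lintegral_ofReal hs.integrableOn (ae_restrict_of_ae h0),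
    ← ofReal_integral_eq_lintegral_ofReal hs'.integrableOn (ae_restrict_of_ae h0'),
    ENNReal.ofReal_eq_ofReal_iff (integral_nonneg_of_ae (ae_restrict_of_ae h0))
      (integral_nonneg_of_ae (ae_restrict_of_ae h0'))]

theorem isNonnegMartingaleFrom_of_isMartingaleFrom [IsProbabilityMeasure Q]
    (hS0 : ∀ u ≤ T, 0 ≤ᵐ[Q] S u) (h : IsMartingaleFrom Q F S T t) :
    IsNonnegMartingaleFrom Q F S T t := by
  refine ⟨fun u h1 h2 => (h.1 u h1 h2).1, fun u v htu huv hvT A hA => ?_⟩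
  have hv := (h.1 v (htu.trans huv) hvT).2
  have hu := (h.1 u htu (huv.trans hvT)).2
  rw [setIntegral_eq_of_setLIntegral_eq hv hu (hS0 v hvT) (hS0 u (huv.trans hvT)),
    ← setIntegral_condExp (F.le u) hv hA]
  exact integral_congr_ae (ae_restrict_of_ae (h.2 u v htu huv hvT))

/-- Only the initial price must be `P`-integrable: `Q` and `P` agree on `F t`, so `S t` has the same
finite mean under both, and the generalized martingale property passes this mean to every later `S
u`. -/
theorem IsNonnegMartingaleFrom.isMartingaleFrom [IsProbabilityMeasure P]
    (hS0 : ∀ u ≤ T, 0 ≤ᵐ[P] S u) (hint : Integrable (S t) P) (ht : t ≤ T)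
    (hQ : IsACDensityOneAt P Q F t) (h : IsNonnegMartingaleFrom Q F S T t) :
    IsMartingaleFrom Q F S T t := by
  have hprob := hQ.1
  have hS0' : ∀ u ≤ T, 0 ≤ᵐ[Q] S u := fun u hu => hQ.2.1.ae_le (hS0 u hu)
  have hint' : ∀ u, t ≤ u → u ≤ T → Integrable (S u) Q := fun u htu huT => by
    have hm := (h.1 u htu huT).mono (F.le u) le_rfl
    refine ⟨hm.aestronglyMeasurable, ?_⟩
    rw [hasFiniteIntegral_iff_ofReal (hS0' u huT)]
    have h1 := h.2 t u le_rfl htu huT Set.univ MeasurableSet.univ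
    rw [setLIntegral_univ, setLIntegral_univ] at h1
    have hmt : Measurable[F t] fun ω => ENNReal.ofReal (S t ω) :=
      ENNReal.measurable_ofReal.comp (h.1 t le_rfl ht)
    rw [h1, ← lintegral_trim (F.le t) hmt, hQ.trim_eq, lintegral_trim (F.le t) hmt,
      ← hasFiniteIntegral_iff_ofReal (hS0 t ht)]
    exact hint.2
  refine ⟨fun u h1 h2 => ⟨h.1 u h1 h2, hint' u h1 h2⟩, fun u v htu huv hvT => ?_⟩
  have huT := huv.trans hvT
  refine (ae_eq_condExp_of_forall_setIntegral_eq (F.le u) (hint' v (htu.trans huv) hvT)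
    (fun _ _ _ => (hint' u htu huT).integrableOn) (fun A hA _ => ?_)
    (h.1 u htu huT).stronglyMeasurable.aestronglyMeasurable).symm
  exact ((setIntegral_eq_of_setLIntegral_eq (hint' v (htu.trans huv) hvT) (hint' u htu huT)
    (hS0' v hvT) (hS0' u huT) A).1 (h.2 u v htu huv hvT A hA)).symm

end Martingale

end InstantProfit

namespace InstantProfit

/-! ### Asymptotic domination by gains from trading. -/

section Trading

variable {Ω : Type*} {m0 : MeasurableSpace Ω} {P : Measure Ω} {F : Filtration ℕ m0}
  {S : ℕ → Ω → ℝ} {T t : ℕ}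

/-- Asymptotic domination: almost surely `X ≤ liminf Y n`. -/
def AsympGE (P : Measure Ω) (Y : ℕ → Ω → ℝ) (X : Ω → ℝ) : Prop :=
  ∀ᵐ ω ∂P, ∀ q : ℚ, (q : ℝ) < X ω → ∀ᶠ n in atTop, (q : ℝ) ≤ Y n ω

theorem AsympGE.of_forall_ae_le {X Y : Ω → ℝ} (h : X ≤ᵐ[P] Y) : AsympGE P (fun _ => Y) X := by
  filter_upwards [h] with ω hω q hq
  exact Eventually.of_forall fun _ => hq.le.trans hω

theorem AsympGE.ae_le {X Y : Ω → ℝ} (h : AsympGE P (fun _ => Y) X) : X ≤ᵐ[P] Y := by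
  filter_upwards [h] with ω hω
  refine le_of_forall_rat_lt_imp_le fun q hq => ?_
  exact (hω q hq).exists.choose_spec

/-- The event that `q < X` while `θ n ≥ 0` and `Y n < q` for infinitely many `n` lies in `G`. On it
`D > 0` almost surely, for otherwise `Y n + θ n * D ≤ Y n < q` infinitely often; hence it is null.
-/
theorem NotSurelyPos.eventually_le {G : MeasurableSpace Ω} {D X : Ω → ℝ} {Y θ : ℕ → Ω → ℝ}
    (hD : NotSurelyPos P G D) (hX : Measurable[G] X) (hY : ∀ n, Measurable[G] (Y n))
    (hθ : ∀ n, Measurable[G] (θ n)) (h : AsympGE P (fun n ω => Y n ω + θ n ω * D ω) X) :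
    ∀ᵐ ω ∂P, ∀ q : ℚ, (q : ℝ) < X ω → ∀ᶠ n in atTop, 0 ≤ θ n ω → (q : ℝ) ≤ Y n ω := by
  refine ae_all_iff.2 fun q => ?_
  let A : Set Ω := {ω | (q : ℝ) < X ω} ∩ ⋂ i : ℕ, ⋃ n : ℕ, ⋃ _ : i ≤ n,
    {ω | 0 ≤ θ n ω} ∩ {ω | Y n ω < q}
  have hA : MeasurableSet[G] A := by
    refine (measurableSet_lt measurable_const hX).inter
      (MeasurableSet.iInter fun i => MeasurableSet.iUnion fun n => MeasurableSet.iUnion fun _ => ?_)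
    exact (measurableSet_le measurable_const (hθ n)).inter
      (measurableSet_lt (hY n) measurable_const)
  have hA0 : P A = 0 := by
    refine hD A hA ?_
    filter_upwards [h] with ω hω hωA
    by_contra hneg
    obtain ⟨N, hN⟩ := eventually_atTop.1 (hω q hωA.1)
    obtain ⟨n, hn, h1, h2⟩ : ∃ n, N ≤ n ∧ 0 ≤ θ n ω ∧ Y n ω < q := by
      obtain ⟨n, hn, h1⟩ := Set.mem_iUnion₂.1 (Set.mem_iInter.1 hωA.2 N)
      exact ⟨n, hn, h1.1, h1.2⟩
    have h3 := hN n hn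
    have h4 := mul_nonpos_of_nonneg_of_nonpos h1 (not_lt.1 hneg)
    linarith
  filter_upwards [measure_eq_zero_iff_ae_notMem.1 hA0] with ω hω hq
  by_contra hcon
  refine hω ⟨hq, Set.mem_iInter.2 fun i => ?_⟩
  obtain ⟨n, hn, h1⟩ := frequently_atTop.1 (not_eventually.1 hcon) i
  push Not at h1
  exact Set.mem_iUnion₂.2 ⟨n, hn, h1.1, h1.2⟩

/-- Removing the last trading period preserves asymptotic domination of an earlier random
variable. -/
theorem AsympGE.of_add_mul {G : MeasurableSpace Ω} {D X : Ω → ℝ} {Y θ : ℕ → Ω → ℝ}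
    (hpos : NotSurelyPos P G D) (hneg : NotSurelyPos P G (-D)) (hX : X ∈ L0 P G)
    (hY : ∀ n, Y n ∈ L0 P G) (hθ : ∀ n, θ n ∈ L0 P G)
    (h : AsympGE P (fun n ω => Y n ω + θ n ω * D ω) X) : AsympGE P Y X := by
  have hXe := hX.ae_eq_mk
  have hYe := ae_all_iff.2 fun n => (hY n).ae_eq_mk
  have hθe := ae_all_iff.2 fun n => (hθ n).ae_eq_mk
  have h' : AsympGE P (fun n ω => (hY n).mk _ ω + (hθ n).mk _ ω * D ω) (hX.mk X) := by
    filter_upwards [h, hXe, hYe, hθe] with ω h1 h2 h3 h4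
    simpa only [← h2, ← h3, ← h4] using h1
  -- Reversing the signs of both position and increment reduces the indices with `θ n ≤ 0` to the
  -- same lemma.
  have h'' : AsympGE P (fun n ω => (hY n).mk _ ω + -(hθ n).mk _ ω * (-D) ω) (hX.mk X) := by
    simpa using h'
  filter_upwards [hXe, hYe, hθe,
    hpos.eventually_le hX.stronglyMeasurable_mk.measurable
      (fun n => (hY n).stronglyMeasurable_mk.measurable)
      (fun n => (hθ n).stronglyMeasurable_mk.measurable) h',
    hneg.eventually_le hX.stronglyMeasurable_mk.measurable
      (fun n => (hY n).stronglyMeasurable_mk.measurable)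
      (fun n => (hθ n).stronglyMeasurable_mk.measurable.neg) h''] with ω h1 h2 h3 h4 h5 q hq
  rw [h1] at hq
  filter_upwards [h4 q hq, h5 q hq] with n h6 h7
  rw [h2 n]
  rcases le_total 0 ((hθ n).mk _ ω) with h8 | h8
  · exact h6 h8
  · exact h7 (neg_nonneg.2 h8)

theorem gain_mem_L0 (hS : ∀ u ≤ T, Measurable[F u] (S u)) {θ : ℕ → Ω → ℝ}
    (hθ : ∀ u ∈ Finset.Ico t T, θ u ∈ L0 P (F u)) {v : ℕ} (hv : v ≤ T) :
    (fun ω => ∑ u ∈ Finset.Ico t v, θ u ω * (S (u + 1) ω - S u ω)) ∈ L0 P (F v) := by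
  change AEStronglyMeasurable[F v] _ P
  rw [← Finset.sum_fn]
  refine Finset.sum_induction _ (fun f => AEStronglyMeasurable[F v] f P) (fun _ _ => .add)
    aestronglyMeasurable_zero fun u hu => ?_
  obtain ⟨h1, h2⟩ := Finset.mem_Ico.1 hu
  have hθu : AEStronglyMeasurable[F v] (θ u) P :=
    (hθ u (Finset.mem_Ico.2 ⟨h1, h2.trans_le hv⟩)).mono (F.mono h2.le)
  have hS1 : Measurable[F v] (S (u + 1)) :=
    (hS (u + 1) (Nat.succ_le_of_lt (h2.trans_le hv))).mono (F.mono h2) le_rfl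
  have hS2 : Measurable[F v] (S u) := (hS u (h2.le.trans hv)).mono (F.mono h2.le) le_rfl
  exact hθu.mul (hS1.sub hS2).stronglyMeasurable.aestronglyMeasurable

theorem NoSureMove.asympGE_gain (hL : NoSureMove P F S T)
    (hS : ∀ u ≤ T, Measurable[F u] (S u)) {X : Ω → ℝ} (hX : X ∈ L0 P (F t))
    {θ : ℕ → ℕ → Ω → ℝ} (hθ : ∀ n, ∀ u ∈ Finset.Ico t T, θ n u ∈ L0 P (F u))
    (h : AsympGE P (fun n ω => ∑ u ∈ Finset.Ico t T, θ n u ω * (S (u + 1) ω - S u ω)) X)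
    {v : ℕ} (htv : t ≤ v) (hv : v ≤ T) :
    AsympGE P (fun n ω => ∑ u ∈ Finset.Ico t v, θ n u ω * (S (u + 1) ω - S u ω)) X := by
  induction hv using Nat.decreasingInduction with
  | self => exact h
  | of_succ v hv ih =>
    refine AsympGE.of_add_mul (hL v hv).1 (hL v hv).2 (AEStronglyMeasurable.mono (F.mono htv) hX)
      (fun n => gain_mem_L0 hS (hθ n) hv.le)
      (fun n => hθ n v (Finset.mem_Ico.2 ⟨htv, hv⟩)) ?_
    simpa only [Finset.sum_Ico_succ_top htv, Pi.sub_apply] using ih (htv.trans v.le_succ)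

/-- Along an almost surely convergent subsequence, discarding the terms `ε ≥ 0` leaves gains that
asymptotically dominate `X`. Peeling off all periods down to `t` leaves the gain 0. -/
theorem NoSureMove.ae_le_zero (hL : NoSureMove P F S T)
    (hS : ∀ u ≤ T, Measurable[F u] (S u)) (ht : t ≤ T) {X : Ω → ℝ} (hX : X ∈ L0 P (F t))
    (h : X ∈ closureInProb P (superReplicable P F S T t)) : X ≤ᵐ[P] 0 := by
  obtain ⟨-, f, hf, hlim⟩ := h
  obtain ⟨ns, -, hns⟩ := hlim.exists_seq_tendsto_ae
  choose θ ε hθ hε hfe using hf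
  have hge : AsympGE P
      (fun n ω => ∑ u ∈ Finset.Ico t T, θ (ns n) u ω * (S (u + 1) ω - S u ω)) X := by
    filter_upwards [hns, ae_all_iff.2 hfe, ae_all_iff.2 fun n => (hε n).2] with ω h1 h2 h3 q hq
    filter_upwards [h1.eventually (lt_mem_nhds hq)] with n hn
    have h4 : 0 ≤ ε (ns n) ω := h3 (ns n)
    rw [h2 (ns n)] at hn
    linarith
  have h0 := hL.asympGE_gain hS hX (fun n => hθ (ns n)) hge le_rfl ht
  simp only [Finset.Ico_self, Finset.sum_empty] at h0
  exact h0.ae_le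

/-! ### Super-replicable claims, AIP and AWIP. -/

theorem mem_superReplicable_of_le (hS : ∀ u ≤ T, Measurable[F u] (S u)) {θ : ℕ → Ω → ℝ}
    (hθ : ∀ u ∈ Finset.Ico t T, θ u ∈ L0 P (F u)) {X : Ω → ℝ} (hX : X ∈ L0 P (F T))
    (hle : ∀ᵐ ω ∂P, X ω ≤ ∑ u ∈ Finset.Ico t T, θ u ω * (S (u + 1) ω - S u ω)) :
    X ∈ superReplicable P F S T t := by
  refine ⟨θ, fun ω => (∑ u ∈ Finset.Ico t T, θ u ω * (S (u + 1) ω - S u ω)) - X ω, hθ,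
    ⟨AEStronglyMeasurable.sub (gain_mem_L0 hS hθ le_rfl) hX, ?_⟩, ?_⟩
  · filter_upwards [hle] with ω hω using sub_nonneg.2 hω
  · filter_upwards with ω
    ring

theorem mem_superReplicable_of_nonpos (hS : ∀ u ≤ T, Measurable[F u] (S u)) {X : Ω → ℝ}
    (hX : X ∈ L0 P (F T)) (h0 : X ≤ᵐ[P] 0) : X ∈ superReplicable P F S T t := by
  refine mem_superReplicable_of_le hS (θ := fun _ _ => 0)
    (fun u _ => aestronglyMeasurable_const) hX ?_
  filter_upwards [h0] with ω hω
  simpa using hω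

theorem mem_superReplicable_of_le_one_step (hS : ∀ u ≤ T, Measurable[F u] (S u)) (ht : t < T)
    {θ X : Ω → ℝ} (hθ : θ ∈ L0 P (F t)) (hX : X ∈ L0 P (F T))
    (hle : ∀ᵐ ω ∂P, X ω ≤ θ ω * (S (t + 1) ω - S t ω)) : X ∈ superReplicable P F S T t := by
  refine mem_superReplicable_of_le hS (θ := fun u => if u = t then θ else fun _ => 0)
    (fun u _ => ?_) hX ?_
  · by_cases h : u = t
    · subst h; simpa using hθ
    · simp only [h, if_false]
      exact aestronglyMeasurable_const
  · filter_upwards [hle] with ω hω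
    rw [Finset.sum_eq_single_of_mem t (Finset.left_mem_Ico.2 ht) fun u _ hu => by simp [hu]]
    simpa using hω

theorem mem_closureInProb {A : Set (Ω → ℝ)} {X : Ω → ℝ} (hX : X ∈ L0 P m0) (h : X ∈ A) :
    X ∈ closureInProb P A :=
  ⟨hX, fun _ => X, fun _ => h, fun ε hε => by simp [hε.ne']⟩

theorem mem_L0pos_of_ae_eq_zero {m : MeasurableSpace Ω} {X : Ω → ℝ} (h : X =ᵐ[P] 0) :
    X ∈ L0pos P m :=
  ⟨(aestronglyMeasurable_zero (m := m)).congr h.symm, h.symm.le⟩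

theorem mem_L0_mono {m m' : MeasurableSpace Ω} (hm : m ≤ m') {X : Ω → ℝ} (hX : X ∈ L0 P m) :
    X ∈ L0 P m' :=
  AEStronglyMeasurable.mono hm hX

theorem mem_superHedgingPrices_zero (ht : t < T) {X : Ω → ℝ} :
    X ∈ superHedgingPrices P F S T t 0 ↔
      X ∈ L0 P (F t) ∧ ∃ R ∈ superReplicable P F S T t, X + R =ᵐ[P] 0 := by
  rw [superHedgingPrices, if_neg ht.ne]
  rfl

/-- A super-hedging price of 0 is minus a super-replicable claim. At `t = T` the condition is
automatic, the price set being the zero class by definition. -/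
theorem aip_of_forall (hS : ∀ u ≤ T, Measurable[F u] (S u))
    (h : ∀ t < T, ∀ R ∈ superReplicable P F S T t, R ∈ L0pos P (F t) → R =ᵐ[P] 0) :
    AIP P F S T := by
  intro t ht
  refine Set.Subset.antisymm ?_ fun x hx => ⟨?_, ?_⟩
  · rintro x ⟨hx, hxneg⟩
    rcases ht.eq_or_lt with rfl | hlt
    · rwa [superHedgingPrices, if_pos rfl] at hx
    · obtain ⟨hxm, R, hR, hxR⟩ := (mem_superHedgingPrices_zero hlt).1 hx
      have hRx : -x =ᵐ[P] R := by
        filter_upwards [hxR] with ω hω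
        have : x ω + R ω = 0 := hω
        simp only [Pi.neg_apply]; linarith
      have hR0 := h t hlt R hR ⟨hxm.neg.congr hRx, by
        filter_upwards [hRx, hxneg.2] with ω h1 h2
        rw [← h1]; simpa using h2⟩
      filter_upwards [hRx, hR0] with ω h1 h2
      rw [h2] at h1
      simpa using h1
  · have hx0 : x =ᵐ[P] 0 := hx
    rcases ht.eq_or_lt with rfl | hlt
    · simpa [superHedgingPrices] using hx0
    · refine (mem_superHedgingPrices_zero hlt).2 ⟨(mem_L0pos_of_ae_eq_zero hx0).1, 0,
        mem_superReplicable_of_nonpos hS (mem_L0pos_of_ae_eq_zero (EventuallyEq.refl _ _)).1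
          (EventuallyLE.refl _ _), ?_⟩
      simpa using hx0
  · exact ⟨(mem_L0pos_of_ae_eq_zero hx).1, EventuallyEq.le hx⟩

theorem AIP.ae_eq_zero (h : AIP P F S T) (ht : t < T) {R : Ω → ℝ}
    (hR : R ∈ superReplicable P F S T t) (hR0 : R ∈ L0pos P (F t)) : R =ᵐ[P] 0 := by
  have hmem : -R ∈ superHedgingPrices P F S T t 0 ∩ L0neg P (F t) := by
    refine ⟨(mem_superHedgingPrices_zero ht).2 ⟨hR0.1.neg, R, hR, by simp⟩, hR0.1.neg, ?_⟩
    filter_upwards [hR0.2] with ω hω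
    simpa using hω
  rw [h t ht.le] at hmem
  have h0 : -R =ᵐ[P] 0 := hmem
  filter_upwards [h0] with ω hω
  simpa using hω

theorem NoSureMove.awip (hL : NoSureMove P F S T) (hS : ∀ u ≤ T, Measurable[F u] (S u)) :
    AWIP P F S T := by
  intro t ht
  refine Set.Subset.antisymm (fun X hX => ?_) fun X hX => ?_
  · exact (hL.ae_le_zero hS ht hX.2.1 hX.1).antisymm hX.2.2
  · exact ⟨mem_closureInProb (mem_L0pos_of_ae_eq_zero hX).1
      (mem_superReplicable_of_nonpos hS (mem_L0pos_of_ae_eq_zero hX).1 (EventuallyEq.le hX)),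
      mem_L0pos_of_ae_eq_zero hX⟩

theorem NoSureMove.aip (hL : NoSureMove P F S T) (hS : ∀ u ≤ T, Measurable[F u] (S u)) :
    AIP P F S T :=
  aip_of_forall hS fun t ht _ hR hR0 => (hL.ae_le_zero hS ht.le hR0.1
    (mem_closureInProb (mem_L0_mono (F.le t) hR0.1) hR)).antisymm hR0.2

/-- Both sides consist of the non-positive elements of `L0 P (F t)`: taking the closure adds nothing
positive, and non-positive claims are super-replicated without trading. -/
theorem NoSureMove.closure_eq (hL : NoSureMove P F S T) (hS : ∀ u ≤ T, Measurable[F u] (S u))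
    (ht : t ≤ T) :
    closureInProb P (superReplicable P F S T t) ∩ L0 P (F t) =
      superReplicable P F S T t ∩ L0 P (F t) := by
  refine Set.Subset.antisymm (fun X hX => ⟨?_, hX.2⟩) fun X hX => ⟨?_, hX.2⟩
  · exact mem_superReplicable_of_nonpos hS (mem_L0_mono (F.mono ht) hX.2)
      (hL.ae_le_zero hS ht hX.2 hX.1)
  · exact mem_closureInProb (mem_L0_mono (F.le t) hX.2) hX.1

theorem indicator_mem_closureInProb [IsFiniteMeasure P] (hS : ∀ u ≤ T, Measurable[F u] (S u))
    (ht : t < T) (σ : ℝ) {A : Set Ω} (hA : MeasurableSet[F t] A)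
    (hpos : ∀ᵐ ω ∂P, ω ∈ A → 0 < σ * (S (t + 1) ω - S t ω)) :
    A.indicator (fun _ => 1) ∈ closureInProb P (superReplicable P F S T t) := by
  have hD : Measurable[F T] fun ω => σ * (S (t + 1) ω - S t ω) :=
    measurable_const.mul (((hS (t + 1) ht).mono (F.mono ht) le_rfl).sub
      ((hS t ht.le).mono (F.mono ht.le) le_rfl))
  -- Gains of the position `n * σ` on `A`, with the excess over 1 thrown away. At almost every point
  -- of `A` the value is eventually exactly 1.
  let f : ℕ → Ω → ℝ := fun n => A.indicator fun ω => min (n * (σ * (S (t + 1) ω - S t ω))) 1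
  have hf : ∀ n, Measurable[F T] (f n) := fun n =>
    ((measurable_const.mul hD).min measurable_const).indicator (F.mono ht.le A hA)
  have hind : Measurable[F t] (A.indicator fun _ => (1 : ℝ)) := measurable_const.indicator hA
  refine ⟨(hind.mono (F.le t) le_rfl).aestronglyMeasurable, f, fun n => ?_, ?_⟩
  · refine mem_superReplicable_of_le_one_step hS ht (θ := A.indicator fun _ => n * σ) ?_
      (hf n).stronglyMeasurable.aestronglyMeasurable (Eventually.of_forall fun ω => ?_)
    · exact (measurable_const.indicator hA).stronglyMeasurable.aestronglyMeasurable
    · by_cases h : ω ∈ A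
      · simp only [f, h, Set.indicator_of_mem]
        exact (min_le_left _ _).trans (by rw [mul_assoc])
      · simp [f, h]
  · refine tendstoInMeasure_of_tendsto_ae
      (fun n => ((hf n).mono (F.le T) le_rfl).aestronglyMeasurable) ?_
    filter_upwards [hpos] with ω hω
    by_cases h : ω ∈ A
    · refine tendsto_const_nhds.congr' ?_
      obtain ⟨N, hN⟩ := exists_nat_ge (1 / (σ * (S (t + 1) ω - S t ω)))
      filter_upwards [eventually_ge_atTop N] with n hn
      have h1 : 1 ≤ n * (σ * (S (t + 1) ω - S t ω)) :=
        (div_le_iff₀ (hω h)).1 (hN.trans (Nat.cast_le.2 hn))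
      simp only [f, h, Set.indicator_of_mem]
      exact (min_eq_right h1).symm
    · simp [f, h]

theorem measure_eq_zero_of_indicator_ae_eq_zero {A : Set Ω} {y : Ω → ℝ}
    (h : A.indicator y =ᵐ[P] 0) (hy : ∀ᵐ ω ∂P, ω ∈ A → y ω ≠ 0) : P A = 0 := by
  refine measure_eq_zero_iff_ae_notMem.2 ?_
  filter_upwards [h, hy] with ω h1 h2 hω
  rw [Set.indicator_of_mem hω] at h1
  exact h2 hω h1

theorem AWIP.noSureMove [IsFiniteMeasure P] (h : AWIP P F S T)
    (hS : ∀ u ≤ T, Measurable[F u] (S u)) : NoSureMove P F S T := by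
  intro u hu
  have key : ∀ (σ : ℝ) (A : Set Ω), MeasurableSet[F u] A →
      (∀ᵐ ω ∂P, ω ∈ A → 0 < σ * (S (u + 1) ω - S u ω)) → P A = 0 := by
    intro σ A hA hpos
    have hind : Measurable[F u] (A.indicator fun _ => (1 : ℝ)) := measurable_const.indicator hA
    have hmem : A.indicator (fun _ => (1 : ℝ)) ∈ zeroClass P := by
      rw [← h u hu.le]
      exact ⟨indicator_mem_closureInProb hS hu σ hA hpos,
        hind.stronglyMeasurable.aestronglyMeasurable,
        Eventually.of_forall fun ω => Set.indicator_nonneg (by simp) ω⟩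
    exact measure_eq_zero_of_indicator_ae_eq_zero hmem (by simp)
  refine ⟨fun A hA hpos => key 1 A hA ?_, fun A hA hpos => key (-1) A hA ?_⟩
  · simpa using hpos
  · simpa using hpos

theorem awip_of_aip_of_closure_eq (hS : ∀ u ≤ T, Measurable[F u] (S u)) (h : AIP P F S T)
    (hcl : ∀ t ≤ T, closureInProb P (superReplicable P F S T t) ∩ L0 P (F t) =
      superReplicable P F S T t ∩ L0 P (F t)) : AWIP P F S T := by
  intro t ht
  refine Set.Subset.antisymm (fun X hX => ?_) fun X hX => ?_
  · have hXR : X ∈ superReplicable P F S T t ∩ L0 P (F t) := hcl t ht ▸ ⟨hX.1, hX.2.1⟩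
    -- AIP says nothing at `t = T`; there the sum of gains is empty and a super-replicable claim is
    -- `-ε ≤ 0`.
    rcases ht.eq_or_lt with rfl | hlt
    · obtain ⟨θ, ε, -, hε, hXe⟩ := hXR.1
      filter_upwards [hXe, hε.2, hX.2.2] with ω h1 h2 h3
      simp only [Finset.Ico_self, Finset.sum_empty, zero_sub, Pi.zero_apply] at h1 h2 h3 ⊢
      linarith
    · exact h.ae_eq_zero hlt hXR.1 hX.2
  · exact ⟨mem_closureInProb (mem_L0pos_of_ae_eq_zero hX).1
      (mem_superReplicable_of_nonpos hS (mem_L0pos_of_ae_eq_zero hX).1 (EventuallyEq.le hX)),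
      mem_L0pos_of_ae_eq_zero hX⟩

/-! ### Weak sign condition, NA and the conditional bounds. -/

/-- No non-null event of `G` on which `D` is almost surely non-negative. -/
def NotSurelyNonneg (P : Measure Ω) (G : MeasurableSpace Ω) (D : Ω → ℝ) : Prop :=
  ∀ A, MeasurableSet[G] A → (∀ᵐ ω ∂P, ω ∈ A → 0 ≤ D ω) → P A = 0

/-- No one-period price increment is almost surely of one weak sign on a non-null event of the
past. -/
def NoSureWeakMove (P : Measure Ω) (F : Filtration ℕ m0) (S : ℕ → Ω → ℝ) (T : ℕ) : Prop :=
  ∀ u < T, NotSurelyNonneg P (F u) (S (u + 1) - S u) ∧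
    NotSurelyNonneg P (F u) (-(S (u + 1) - S u))

theorem NotSurelyNonneg.notSurelyPos {G : MeasurableSpace Ω} {D : Ω → ℝ}
    (h : NotSurelyNonneg P G D) : NotSurelyPos P G D := fun A hA hpos =>
  h A hA (hpos.mono fun _ h1 h2 => (h1 h2).le)

theorem NoSureWeakMove.noSureMove (h : NoSureWeakMove P F S T) : NoSureMove P F S T :=
  fun u hu => ⟨(h u hu).1.notSurelyPos, (h u hu).2.notSurelyPos⟩

theorem ae_eq_zero_of_mul_nonneg {G : MeasurableSpace Ω} {D θ : Ω → ℝ}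
    (hpos : NotSurelyNonneg P G D) (hneg : NotSurelyNonneg P G (-D)) (hθ : θ ∈ L0 P G)
    (h : ∀ᵐ ω ∂P, 0 ≤ θ ω * D ω) : θ =ᵐ[P] 0 := by
  have hm : Measurable[G] (hθ.mk θ) := hθ.stronglyMeasurable_mk.measurable
  have h1 := hpos {ω | 0 < hθ.mk θ ω} (measurableSet_lt measurable_const hm) (by
    filter_upwards [h, hθ.ae_eq_mk] with ω h1 h2 h3
    rw [h2] at h1
    exact nonneg_of_mul_nonneg_right h1 h3)
  have h2 := hneg {ω | hθ.mk θ ω < 0} (measurableSet_lt hm measurable_const) (by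
    filter_upwards [h, hθ.ae_eq_mk] with ω h1 h2 h3
    rw [h2, ← neg_mul_neg] at h1
    exact nonneg_of_mul_nonneg_right h1 (neg_pos.2 h3))
  filter_upwards [measure_eq_zero_iff_ae_notMem.1 h1, measure_eq_zero_iff_ae_notMem.1 h2,
    hθ.ae_eq_mk] with ω h3 h4 h5
  rw [h5]
  exact le_antisymm (not_lt.1 h3) (not_lt.1 h4)

/-- If the final gain is non-negative, backward peeling makes every partial gain non-negative.
Forward in time, a zero gain up to `v` then gives `θ v * (S (v + 1) - S v) ≥ 0`, which forces `θ v =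
0`, so the gain stays zero. -/
theorem NoSureWeakMove.na (h : NoSureWeakMove P F S T) (hS : ∀ u ≤ T, Measurable[F u] (S u)) :
    NA P F S T := by
  intro t ht
  refine Set.Subset.antisymm ?_ fun X hX => ⟨mem_superReplicable_of_nonpos hS
    (mem_L0pos_of_ae_eq_zero hX).1 (EventuallyEq.le hX), mem_L0pos_of_ae_eq_zero hX⟩
  rintro X ⟨⟨θ, ε, hθ, hε, hXe⟩, -, hX0⟩
  have hge : ∀ v, t ≤ v → v ≤ T →
      ∀ᵐ ω ∂P, 0 ≤ ∑ u ∈ Finset.Ico t v, θ u ω * (S (u + 1) ω - S u ω) := fun v htv hv => by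
    refine AsympGE.ae_le (X := fun _ => 0) (h.noSureMove.asympGE_gain hS
      aestronglyMeasurable_const (fun _ => hθ) (AsympGE.of_forall_ae_le ?_) htv hv)
    filter_upwards [hXe, hε.2, hX0] with ω h1 h2 h3
    rw [h1] at h3
    simp only [Pi.zero_apply] at h2 h3
    linarith
  have heq : ∀ v, t ≤ v → v ≤ T →
      ∀ᵐ ω ∂P, ∑ u ∈ Finset.Ico t v, θ u ω * (S (u + 1) ω - S u ω) = 0 := by
    intro v htv hv
    induction v, htv using Nat.le_induction with
    | base => simp
    | succ v htv ih =>
      have ih := ih (Nat.le_of_succ_le hv)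
      have hge' := hge (v + 1) (htv.trans v.le_succ) hv
      simp only [Finset.sum_Ico_succ_top htv] at hge' ⊢
      have hθ0 := ae_eq_zero_of_mul_nonneg (h v hv).1 (h v hv).2
        (hθ v (Finset.mem_Ico.2 ⟨htv, hv⟩)) (by
          filter_upwards [ih, hge'] with ω h1 h2
          simpa [h1] using h2)
      filter_upwards [ih, hθ0] with ω h1 h2
      simp [h1, h2]
  filter_upwards [hXe, hε.2, hX0, heq T ht le_rfl] with ω h1 h2 h3 h4
  rw [h4] at h1
  simp only [Pi.zero_apply] at h2 h3 ⊢
  linarith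

theorem NA.aip (h : NA P F S T) (hS : ∀ u ≤ T, Measurable[F u] (S u)) : AIP P F S T := by
  refine aip_of_forall hS fun t ht R hR hR0 => ?_
  have : R ∈ zeroClass P := h t ht.le ▸ ⟨hR, mem_L0_mono (F.mono ht.le) hR0.1, hR0.2⟩
  exact this

/-- Holding `σ` units on `A` for one period would lock in the amount `y`, already known at time `t`.
The measurable lower bound `y` is what AIP needs beyond strict positivity of the gain. -/
theorem AIP.measure_eq_zero (h : AIP P F S T) (hS : ∀ u ≤ T, Measurable[F u] (S u))
    (ht : t < T) (σ : ℝ) {y : Ω → ℝ} {A : Set Ω} (hA : MeasurableSet[F t] A)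
    (hy : Measurable[F t] y)
    (hlt : ∀ᵐ ω ∂P, ω ∈ A → 0 < y ω ∧ y ω ≤ σ * (S (t + 1) ω - S t ω)) : P A = 0 := by
  have hm : Measurable[F t] (A.indicator y) := hy.indicator hA
  refine measure_eq_zero_of_indicator_ae_eq_zero (y := y) (h.ae_eq_zero ht
    (mem_superReplicable_of_le_one_step hS ht (θ := A.indicator fun _ => σ)
      (measurable_const.indicator hA).stronglyMeasurable.aestronglyMeasurable
      (mem_L0_mono (F.mono ht.le) hm.stronglyMeasurable.aestronglyMeasurable) ?_)
    ⟨hm.stronglyMeasurable.aestronglyMeasurable, ?_⟩) ?_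
  · filter_upwards [hlt] with ω hω
    by_cases h : ω ∈ A
    · simpa [h] using (hω h).2
    · simp [h]
  · filter_upwards [hlt] with ω hω
    by_cases h : ω ∈ A
    · simpa [h] using (hω h).1.le
    · simp [h]
  · filter_upwards [hlt] with ω hω hA using (hω hA).1.ne'

theorem AIP.noSureWeakMove [IsFiniteMeasure P] (h : AIP P F S T)
    (hS : ∀ u ≤ T, Measurable[F u] (S u))
    (hne : ∀ t < T, P {ω | condEssInf P (F t) (S (t + 1)) ω = (S t ω : EReal)} = 0 ∧
      P {ω | condEssSup P (F t) (S (t + 1)) ω = (S t ω : EReal)} = 0) :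
    NoSureWeakMove P F S T := by
  intro u hu
  have hS1 := (hS (u + 1) hu).mono (F.le _) le_rfl
  have hSu : Measurable[F u] fun ω => (S u ω : EReal) := measurable_coe_real_ereal.comp (hS u hu.le)
  constructor
  · intro A hA hpos
    classical
    obtain ⟨hg, hgle, hgmax⟩ := condEssInf_spec P hS1 (F.le u)
    -- Extended by `⊥` off `A`, the current price is an `F u`-measurable lower bound for `S (u +
    -- 1)`, so it lies below the conditional infimum on `A`; by `hne` it does so strictly, and the
    -- gap is the sure profit `y`.
    have hle := hgmax (fun ω => if ω ∈ A then (S u ω : EReal) else ⊥)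
      (Measurable.ite hA hSu measurable_const) (by
        filter_upwards [hpos] with ω hω
        split_ifs with hωA
        · exact EReal.coe_le_coe_iff.2 (sub_nonneg.1 (hω hωA))
        · exact bot_le)
    refine h.measure_eq_zero hS hu 1 hA
      (y := fun ω => (condEssInf P (F u) (S (u + 1)) ω).toReal - S u ω)
      ((hg.ereal_toReal).sub (hS u hu.le)) ?_
    filter_upwards [hle, hgle, measure_eq_zero_iff_ae_notMem.1 (hne u hu).1] with ω h1 h2 h3 hωA
    rw [if_pos hωA] at h1
    have hlt := lt_of_le_of_ne h1 (Ne.symm h3)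
    -- On `A` the infimum lies above the real `S u` and at or below the real `S (u + 1)`, hence is
    -- finite; the default values of `toReal` matter only off `A` or on a null set.
    lift condEssInf P (F u) (S (u + 1)) ω to ℝ using
      ⟨ne_top_of_le_ne_top (EReal.coe_ne_top _) h2, ne_bot_of_gt hlt⟩ with c
    rw [EReal.coe_le_coe_iff] at h2
    rw [EReal.coe_lt_coe_iff] at hlt
    simp only [EReal.toReal_coe]
    constructor <;> linarith
  · intro A hA hpos
    classical
    obtain ⟨hg, hgle, hgmin⟩ := condEssSup_spec P hS1 (F.le u)
    have hle := hgmin (fun ω => if ω ∈ A then (S u ω : EReal) else ⊤)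
      (Measurable.ite hA hSu measurable_const) (by
        filter_upwards [hpos] with ω hω
        split_ifs with hωA
        · exact EReal.coe_le_coe_iff.2 (sub_nonpos.1 (neg_nonneg.1 (hω hωA)))
        · exact le_top)
    refine h.measure_eq_zero hS hu (-1) hA
      (y := fun ω => S u ω - (condEssSup P (F u) (S (u + 1)) ω).toReal)
      ((hS u hu.le).sub (hg.ereal_toReal)) ?_
    filter_upwards [hle, hgle, measure_eq_zero_iff_ae_notMem.1 (hne u hu).2] with ω h1 h2 h3 hωA
    rw [if_pos hωA] at h1
    have hlt := lt_of_le_of_ne h1 h3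
    lift condEssSup P (F u) (S (u + 1)) ω to ℝ using
      ⟨hlt.ne_top, ne_bot_of_le_ne_bot (EReal.coe_ne_bot _) h2⟩ with c
    rw [EReal.coe_le_coe_iff] at h2
    rw [EReal.coe_lt_coe_iff] at hlt
    simp only [EReal.toReal_coe]
    constructor <;> linarith

end Trading

end InstantProfit

theorem theorem3p9 {Ω : Type*} {m0 : MeasurableSpace Ω} (P : Measure Ω) [IsProbabilityMeasure P]
    (F : Filtration ℕ m0) (T : ℕ) (S : ℕ → Ω → ℝ)
    (hS_adapted : ∀ t ≤ T, Measurable[F t] (S t))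
    (hS_nonneg : ∀ t ≤ T, 0 ≤ᵐ[P] S t) :
    List.TFAE
      [InstantProfit.AWIP P F S T,
       ∀ t ≤ T, ∃ Q : Measure Ω, InstantProfit.IsACDensityOneAt P Q F t ∧
         InstantProfit.IsNonnegMartingaleFrom Q F S T t,
       InstantProfit.AIP P F S T ∧
         ∀ t ≤ T,
           InstantProfit.closureInProb P (InstantProfit.superReplicable P F S T t) ∩
               InstantProfit.L0 P (F t) =
             InstantProfit.superReplicable P F S T t ∩ InstantProfit.L0 P (F t)] ∧
    ((∀ t ≤ T, Integrable (S t) P) →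
      (InstantProfit.AWIP P F S T ↔
        ∀ t ≤ T, ∃ Q : Measure Ω, InstantProfit.IsACDensityOneAt P Q F t ∧
          InstantProfit.IsMartingaleFrom Q F S T t)) ∧
    ((∀ t < T, P {ω | InstantProfit.condEssInf P (F t) (S (t + 1)) ω = (S t ω : EReal)} = 0 ∧
        P {ω | InstantProfit.condEssSup P (F t) (S (t + 1)) ω = (S t ω : EReal)} = 0) →
      List.TFAE
        [InstantProfit.AWIP P F S T, InstantProfit.AIP P F S T, InstantProfit.NA P F S T]) := by
  have hLawip : InstantProfit.AWIP P F S T ↔ InstantProfit.NoSureMove P F S T :=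
    ⟨fun h => h.noSureMove hS_adapted, fun h => h.awip hS_adapted⟩
  refine ⟨?_, fun hint => ⟨fun h t ht => ?_, fun h => hLawip.2 ?_⟩, fun hne => ?_⟩
  · tfae_have 1 → 2 := fun h t ht =>
      (hLawip.1 h).exists_martingale_measure hS_adapted hS_nonneg ht
    tfae_have 2 → 1 := fun h => hLawip.2
      (InstantProfit.noSureMove_of_martingale_measures hS_adapted hS_nonneg h)
    tfae_have 1 → 3 := fun h => ⟨(hLawip.1 h).aip hS_adapted,
      fun t ht => (hLawip.1 h).closure_eq hS_adapted ht⟩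
    tfae_have 3 → 1 := fun h => InstantProfit.awip_of_aip_of_closure_eq hS_adapted h.1 h.2
    tfae_finish
  · obtain ⟨Q, hQ, hmart⟩ := (hLawip.1 h).exists_martingale_measure hS_adapted hS_nonneg ht
    exact ⟨Q, hQ, hmart.isMartingaleFrom hS_nonneg (hint t ht) ht hQ⟩
  · refine InstantProfit.noSureMove_of_martingale_measures hS_adapted hS_nonneg fun t ht => ?_
    obtain ⟨Q, hQ, hmart⟩ := h t ht
    have := hQ.1
    exact ⟨Q, hQ, InstantProfit.isNonnegMartingaleFrom_of_isMartingaleFrom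
      (fun u hu => hQ.2.1.ae_le (hS_nonneg u hu)) hmart⟩
  · tfae_have 1 → 2 := fun h => (hLawip.1 h).aip hS_adapted
    tfae_have 2 → 1 := fun h => (h.noSureWeakMove hS_adapted hne).noSureMove.awip hS_adapted
    tfae_have 2 → 3 := fun h => (h.noSureWeakMove hS_adapted hne).na hS_adapted
    tfae_have 3 → 2 := fun h => h.aip hS_adapted
    tfae_finish
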